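/- Let $q\in\mathbb{C}$ be non-zero and not a root of unity. Let $U^+=U_q^+(B_2)$ be the $\mathbb{C}$-algebra generated by $e_1,e_2$ subject to the quantum Serre relations $$e_1^2e_2-(q^2+q^{-2})e_1e_2e_1+e_2e_1^2=0,$$ $$e_2^3e_1-(q^2+1+q^{-2})e_2^2e_1e_2+(q^2+1+q^{-2})e_2e_1e_2^2-e_1e_2^3=0.$$ Set $$e_3=e_1e_2-q^2e_2e_1,\qquad z=e_2e_3-q^2e_3e_2,$$ $$z'=(1-q^{-4})(1-q^{-2})e_3e_1e_2+q^{-4}(1-q^{-2})e_3^2+(1-q^{-4})ze_1.$$ For $(\alpha,\beta)\in\mathbb{C}^2\setminus\{(0,0)\}$ let $A_{\alpha,\beta}=U^+/\langle z-\alpha,\,z'-\beta\rangle$ be the quotient of $U^+$ by the two-sided ideal generated by $z-\alpha$ and $z'-\beta$, and let $\widetilde{x}$ denote the image of $x\in U^+$ in $A_{\alpha,\beta}$. Then $A_{\alpha,\beta}\neq 0$ (so that $\mathbb{C}^*=\mathbb{C}\setminus\{0\}$ is identified with the set of non-zero scalars of $A_{\alpha,\beta}$), and the group $U(A_{\alpha,\beta})$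 of invertible elements of $A_{\alpha,\beta}$ is as follows. - If $\alpha=0$, then $\widetilde{e_3}$ is invertible in $A_{\alpha,\beta}$ and $U(A_{\alpha,\beta})=\{\lambda\,\widetilde{e_3}^{\,i}\mid\lambda\in\mathbb{C}^*,\ i\in\mathbb{Z}\}$. - If $\beta=0$, then $\widetilde{e_1}$ is regular (neither a left nor a right zero divisor), there is a (necessarily unique) element of $A_{\alpha,\beta}$, denoted $\widetilde{e_1}^{-1}\widetilde{e_3}^{\,2}$, with $\widetilde{e_1}\cdot\bigl(\widetilde{e_1}^{-1}\widetilde{e_3}^{\,2}\bigr)=\widetilde{e_3}^{\,2}$, it is invertible in $A_{\alpha,\beta}$, and $U(A_{\alpha,\beta})=\{\lambda\,(\widetilde{e_1}^{-1}\widetilde{e_3}^{\,2})^i\mid\lambda\in\mathbb{C}^*,\ i\in\mathbb{Z}\}$. - If $\alpha\neq0$ and $\beta\neq0$, then $U(A_{\alpha,\beta})=\mathbb{C}^*$. -/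

import Mathlib

namespace UqB2

noncomputable section

/-- The quantum Serre relations of type `B₂` in the free algebra `ℂ⟨e₁, e₂⟩`
(`FreeAlgebra.ι ℂ 0` is `e₁` and `FreeAlgebra.ι ℂ 1` is `e₂`). -/
inductive SerreRel (q : ℂ) : FreeAlgebra ℂ (Fin 2) → FreeAlgebra ℂ (Fin 2) → Prop
  | serre₁ (e₁ e₂ : FreeAlgebra ℂ (Fin 2))
      (h₁ : e₁ = FreeAlgebra.ι ℂ 0) (h₂ : e₂ = FreeAlgebra.ι ℂ 1) :
      SerreRel q
        (e₁ ^ 2 * e₂ - (q ^ 2 + q ^ (-2 : ℤ)) • (e₁ * e₂ * e₁) + e₂ * e₁ ^ 2) 0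
  | serre₂ (e₁ e₂ : FreeAlgebra ℂ (Fin 2))
      (h₁ : e₁ = FreeAlgebra.ι ℂ 0) (h₂ : e₂ = FreeAlgebra.ι ℂ 1) :
      SerreRel q
        (e₂ ^ 3 * e₁ - (q ^ 2 + 1 + q ^ (-2 : ℤ)) • (e₂ ^ 2 * e₁ * e₂)
          + (q ^ 2 + 1 + q ^ (-2 : ℤ)) • (e₂ * e₁ * e₂ ^ 2) - e₁ * e₂ ^ 3) 0

/-- The algebra `U⁺ = U_q⁺(B₂)`: the `ℂ`-algebra generated by `e₁, e₂` subject to the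
quantum Serre relations. -/
abbrev UPlus (q : ℂ) : Type := RingQuot (SerreRel q)

/-- The generator `e₁` of `U⁺`. -/
def e₁ (q : ℂ) : UPlus q := RingQuot.mkAlgHom ℂ (SerreRel q) (FreeAlgebra.ι ℂ 0)

/-- The generator `e₂` of `U⁺`. -/
def e₂ (q : ℂ) : UPlus q := RingQuot.mkAlgHom ℂ (SerreRel q) (FreeAlgebra.ι ℂ 1)

/-- `e₃ = e₁ e₂ - q² e₂ e₁`. -/
def e₃ (q : ℂ) : UPlus q := e₁ q * e₂ q - q ^ 2 • (e₂ q * e₁ q)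

/-- `z = e₂ e₃ - q² e₃ e₂`. -/
def z (q : ℂ) : UPlus q := e₂ q * e₃ q - q ^ 2 • (e₃ q * e₂ q)

/-- `z' = (1 - q⁻⁴)(1 - q⁻²) e₃ e₁ e₂ + q⁻⁴ (1 - q⁻²) e₃² + (1 - q⁻⁴) z e₁`. -/
def zPrime (q : ℂ) : UPlus q :=
  ((1 - q ^ (-4 : ℤ)) * (1 - q ^ (-2 : ℤ))) • (e₃ q * e₁ q * e₂ q)
    + (q ^ (-4 : ℤ) * (1 - q ^ (-2 : ℤ))) • e₃ q ^ 2
    + (1 - q ^ (-4 : ℤ)) • (z q * e₁ q)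

/-- The relations `z - α = 0` and `z' - β = 0` in `U⁺`. -/
inductive CentralRel (q α β : ℂ) : UPlus q → UPlus q → Prop
  | z_sub : CentralRel q α β (z q - algebraMap ℂ (UPlus q) α) 0
  | zPrime_sub : CentralRel q α β (zPrime q - algebraMap ℂ (UPlus q) β) 0

/-- The algebra `A_{α,β} = U⁺ / ⟨z - α, z' - β⟩`, the quotient of `U⁺` by the two-sided ideal
generated by `z - α` and `z' - β`. -/
abbrev A (q α β : ℂ) : Type := RingQuot (CentralRel q α β)

/-- The canonical surjection `x ↦ x̃` from `U⁺` onto `A_{α,β}`. -/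
def toA (q α β : ℂ) : UPlus q →ₐ[ℂ] A q α β := RingQuot.mkAlgHom ℂ (CentralRel q α β)

end

end UqB2

/-! ### The quantum torus acting on itself. -/

namespace UqB2

noncomputable section

/-! Sending `e₁`, `e₃` to the two generators of the quantum torus forces the image of `e₂`: the
relation `z' = β` can be solved for it, giving a combination of three monomials with coefficients
`b₁` (proportional to `β`), `b₂ ≠ 0` and `b₃` (proportional to `α`). For `(α, β) ≠ (0, 0)` this
representation is faithful (`torusRep_injective`): the products `e₁ ^ i * e₃ ^ ε * e₂ ^ k` with `ε ∈
{0, 1}` span `A`, and extreme terms show their images to be independent.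

Units of the torus are multiples of monomials, so each unit of `A` has an exponent in `ℤ × ℤ`. To
see which exponents occur, choose a grading in which the top part of the image of `e₂` is a binomial
of degree 1, and a graded module, one-dimensional in each degree, on which that binomial kills the
degree 0 vector. The part of degree at most 0 is then stable under `A`, so monomials in the image of
`A` have degree at most 0 (`degree_le_zero`). Applied to a unit and its inverse, this puts the
exponent on a line, or at 0 when two such gradings are available. Explicit inverses show that every
point of the line occurs. -/

/-- The underlying space of the quantum torus, with basis indexed by the exponents. -/
abbrev TorusSpace : Type := ℤ × ℤ →₀ ℂ

/-- Left multiplication by the monomial of exponent `g` in the quantum torus. -/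
def monomialOp (q : ℂ) (g : ℤ × ℤ) : Module.End ℂ TorusSpace :=
  Finsupp.linearCombination ℂ fun h => Finsupp.single (g + h) (q ^ (2 * g.2 * h.1))

theorem monomialOp_single (q : ℂ) (g h : ℤ × ℤ) (c : ℂ) :
    monomialOp q g (Finsupp.single h c) = Finsupp.single (g + h) (c * q ^ (2 * g.2 * h.1)) := by
  simp [monomialOp]

theorem monomialOp_apply (q : ℂ) (g k : ℤ × ℤ) (v : TorusSpace) :
    monomialOp q g v k = q ^ (2 * g.2 * (k.1 - g.1)) * v (k - g) := by
  induction v using Finsupp.induction_linear with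
  | zero => simp
  | add v w hv hw => simp [hv, hw, mul_add]
  | single h c =>
    rw [monomialOp_single]
    by_cases hk : g + h = k
    · subst hk
      simp [mul_comm]
    · have hk' : h ≠ k - g := fun h' => hk (by rw [h']; abel)
      rw [Finsupp.single_eq_of_ne' hk, Finsupp.single_eq_of_ne' hk', mul_zero]

theorem monomialOp_mul {q : ℂ} (hq₀ : q ≠ 0) (g h : ℤ × ℤ) :
    monomialOp q g * monomialOp q h = q ^ (2 * g.2 * h.1) • monomialOp q (g + h) := by
  refine Finsupp.lhom_ext fun k c => ?_
  simp only [Module.End.mul_apply, LinearMap.smul_apply, monomialOp_single, Finsupp.smul_single,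
    smul_eq_mul, add_assoc]
  congr 1
  have e : (2 * g.2 * h.1 + 2 * (g + h).2 * k.1 : ℤ) = 2 * h.2 * k.1 + 2 * g.2 * (h + k).1 := by
    simp only [Prod.fst_add, Prod.snd_add]; ring
  rw [mul_assoc, ← zpow_add₀ hq₀, ← e, zpow_add₀ hq₀]
  ring

theorem monomialOp_zero (q : ℂ) : monomialOp q 0 = 1 := by
  refine Finsupp.lhom_ext fun k c => ?_
  simp [monomialOp_single]

/-- The operator of left multiplication by an element of the quantum torus. -/
def torusOp (q : ℂ) : TorusSpace →ₗ[ℂ] Module.End ℂ TorusSpace :=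
  Finsupp.linearCombination ℂ (monomialOp q)

theorem torusOp_single (q : ℂ) (g : ℤ × ℤ) (c : ℂ) :
    torusOp q (Finsupp.single g c) = c • monomialOp q g := by
  simp [torusOp]

/-- A torus element is recovered from its operator by applying it to the identity, the basis vector
of exponent 0. -/
theorem torusOp_apply_one (q : ℂ) (v : TorusSpace) :
    torusOp q v (Finsupp.single 0 1) = v := by
  induction v using Finsupp.induction_linear with
  | zero => simp
  | add v w hv hw => simp [hv, hw]
  | single h c => simp [torusOp_single, monomialOp_single]

theorem mul_mem_range_torusOp {q : ℂ} (hq₀ : q ≠ 0) {S T : Module.End ℂ TorusSpace}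
    (hS : S ∈ LinearMap.range (torusOp q)) (hT : T ∈ LinearMap.range (torusOp q)) :
    S * T ∈ LinearMap.range (torusOp q) := by
  obtain ⟨v, rfl⟩ := hS
  obtain ⟨w, rfl⟩ := hT
  induction v using Finsupp.induction_linear with
  | zero => simp
  | add v v' hv hv' => rw [map_add, add_mul]; exact Submodule.add_mem _ hv hv'
  | single g c =>
    induction w using Finsupp.induction_linear with
    | zero => simp
    | add w w' hw hw' => rw [map_add, mul_add]; exact Submodule.add_mem _ hw hw'
    | single h d =>
      refine ⟨Finsupp.single (g + h) (c * d * q ^ (2 * g.2 * h.1)), ?_⟩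
      simp only [torusOp_single, smul_mul_assoc, mul_smul_comm, monomialOp_mul hq₀, smul_smul]
      congr 1; ring

/-- The value of a product at a point which is uniquely a sum of exponents. -/
theorem torusOp_apply_of_uniqueAdd (q : ℂ) {v w : TorusSpace} {g h : ℤ × ℤ}
    (hu : UniqueAdd v.support w.support g h) :
    torusOp q v w (g + h) = v g * w h * q ^ (2 * g.2 * h.1) := by
  rw [torusOp, Finsupp.linearCombination_apply, Finsupp.sum, LinearMap.sum_apply,
    Finsupp.finsetSum_apply, Finset.sum_eq_single g]
  · simp [monomialOp_apply]; ring
  · intro k hk hkg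
    rw [LinearMap.smul_apply, Finsupp.smul_apply, monomialOp_apply]
    have : w (g + h - k) = 0 := by
      by_contra hw
      exact hkg (hu hk (Finsupp.mem_support_iff.2 hw) (by abel)).1
    simp [this]
  · intro hg
    simp [Finsupp.notMem_support_iff.1 hg]

/-- The units of the quantum torus are the non-zero multiples of monomials. -/
theorem exists_eq_single_of_torusOp_apply_eq_one {q : ℂ} (hq₀ : q ≠ 0) {v w : TorusSpace}
    (hvw : torusOp q v w = Finsupp.single 0 1) :
    ∃ (g : ℤ × ℤ) (c : ℂ), c ≠ 0 ∧ v = Finsupp.single g c := by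
  have hv : v ≠ 0 := by
    rintro rfl
    simp [eq_comm] at hvw
  have hw : w ≠ 0 := by
    rintro rfl
    simp [eq_comm] at hvw
  have hcv : 0 < v.support.card := Finset.card_pos.2 (Finsupp.support_nonempty_iff.2 hv)
  have hcw : 0 < w.support.card := Finset.card_pos.2 (Finsupp.support_nonempty_iff.2 hw)
  by_cases hc : 1 < v.support.card * w.support.card
  · exfalso
    -- Unless both supports are singletons, two different pairs of exponents have uniquely attained
    -- sums. The product is non-zero at both sums, hence both are 0, contradicting uniqueness.
    obtain ⟨p, hp, r, hr, hpr, hup, hur⟩ := TwoUniqueSums.uniqueAdd_of_one_lt_card hc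
    rw [Finset.mem_product] at hp hr
    have key : ∀ s : (ℤ × ℤ) × (ℤ × ℤ), s.1 ∈ v.support → s.2 ∈ w.support →
        UniqueAdd v.support w.support s.1 s.2 → s.1 + s.2 = 0 := by
      intro s h₁ h₂ hu
      have := torusOp_apply_of_uniqueAdd q hu
      rw [hvw] at this
      by_contra hne
      rw [Finsupp.single_eq_of_ne hne] at this
      exact mul_ne_zero (mul_ne_zero (Finsupp.mem_support_iff.1 h₁) (Finsupp.mem_support_iff.1 h₂))
        (zpow_ne_zero _ hq₀) this.symm
    have := hup hr.1 hr.2 ((key r hr.1 hr.2 hur).trans (key p hp.1 hp.2 hup).symm)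
    exact hpr (Prod.ext this.1.symm this.2.symm)
  · have h1 : v.support.card = 1 := by nlinarith
    obtain ⟨g, hg, hv'⟩ := Finsupp.card_support_eq_one.1 h1
    exact ⟨g, v g, hg, hv'⟩

theorem monomialOp_smul_injective {q : ℂ} {g h : ℤ × ℤ} {c d : ℂ} (hc : c ≠ 0)
    (H : c • monomialOp q g = d • monomialOp q h) : g = h := by
  have := congrArg (fun S : Module.End ℂ TorusSpace => S (Finsupp.single 0 1)) H
  simp only [LinearMap.smul_apply, monomialOp_single, add_zero, Finsupp.smul_single] at this
  rcases Finsupp.single_eq_single_iff _ _ _ _ |>.1 this with h' | h'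
  · exact h'.1
  · simp [hc] at h'

/-! ### Relations in `A` and its universal property. -/

/-- The image of `e₁` in `A`. -/
def x₁ (q α β : ℂ) : A q α β := toA q α β (e₁ q)

/-- The image of `e₂` in `A`. -/
def x₂ (q α β : ℂ) : A q α β := toA q α β (e₂ q)

/-- The image of `e₃` in `A`. -/
def x₃ (q α β : ℂ) : A q α β := toA q α β (e₃ q)

theorem A_induction {q α β : ℂ} {p : A q α β → Prop} (h₁ : p (x₁ q α β)) (h₂ : p (x₂ q α β))
    (halg : ∀ c : ℂ, p (algebraMap ℂ _ c)) (hadd : ∀ a b, p a → p b → p (a + b))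
    (hmul : ∀ a b, p a → p b → p (a * b)) (a : A q α β) : p a := by
  obtain ⟨b, rfl⟩ := RingQuot.mkAlgHom_surjective ℂ (CentralRel q α β) a
  obtain ⟨f, rfl⟩ := RingQuot.mkAlgHom_surjective ℂ (SerreRel q) b
  induction f using FreeAlgebra.induction with
  | grade0 r => simpa only [AlgHom.commutes] using halg r
  | grade1 i =>
    fin_cases i
    · exact h₁
    · exact h₂
  | mul a b ha hb => simpa only [map_mul] using hmul _ _ ha hb
  | add a b ha hb => simpa only [map_add] using hadd _ _ ha hb

/-- This is the first Serre relation rewritten in terms of `e₃`. -/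
theorem e₁_mul_e₃ {q : ℂ} (hq₀ : q ≠ 0) : e₁ q * e₃ q = q ^ (-2 : ℤ) • (e₃ q * e₁ q) := by
  have h := RingQuot.mkAlgHom_rel ℂ (SerreRel.serre₁ (q := q) _ _ rfl rfl)
  simp only [map_add, map_sub, map_mul, map_smul, map_pow, map_zero] at h
  change e₁ q ^ 2 * e₂ q - (q ^ 2 + q ^ (-2 : ℤ)) • (e₁ q * e₂ q * e₁ q) + e₂ q * e₁ q ^ 2 = 0 at h
  rw [← sub_eq_zero, ← h, e₃]
  simp only [mul_sub, sub_mul, mul_smul_comm, smul_mul_assoc, pow_two (e₁ q), mul_assoc]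
  match_scalars <;> field_simp <;> ring

section Relations

variable {q α β : ℂ}

theorem x₁_mul_x₃ (hq₀ : q ≠ 0) :
    x₁ q α β * x₃ q α β = q ^ (-2 : ℤ) • (x₃ q α β * x₁ q α β) := by
  simpa only [map_mul, map_smul, x₁, x₃] using congrArg (toA q α β) (e₁_mul_e₃ hq₀)

theorem x₁_mul_x₂ : x₁ q α β * x₂ q α β = x₃ q α β + q ^ 2 • (x₂ q α β * x₁ q α β) := by
  simp [x₁, x₂, x₃, e₃]

theorem toA_z : toA q α β (z q) = algebraMap ℂ _ α := by
  have h := RingQuot.mkAlgHom_rel ℂ (CentralRel.z_sub (q := q) (α := α) (β := β))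
  rw [map_sub, map_zero, sub_eq_zero, AlgHom.commutes] at h
  exact h

theorem x₂_mul_x₃ : x₂ q α β * x₃ q α β = algebraMap ℂ _ α + q ^ 2 • (x₃ q α β * x₂ q α β) := by
  rw [← toA_z]
  simp [x₂, x₃, z]

theorem quadratic_relation :
    ((1 - q ^ (-4 : ℤ)) * (1 - q ^ (-2 : ℤ))) • (x₃ q α β * x₁ q α β * x₂ q α β)
    + (q ^ (-4 : ℤ) * (1 - q ^ (-2 : ℤ))) • x₃ q α β ^ 2
    + ((1 - q ^ (-4 : ℤ)) * α) • x₁ q α β = algebraMap ℂ _ β := by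
  have h := RingQuot.mkAlgHom_rel ℂ (CentralRel.zPrime_sub (q := q) (α := α) (β := β))
  rw [map_sub, map_zero, sub_eq_zero, AlgHom.commutes] at h
  change toA q α β (zPrime q) = _ at h
  rw [← h, zPrime]
  simp only [map_add, map_mul, map_smul, map_pow, toA_z, ← Algebra.smul_def, smul_smul]
  rfl

/-- The universal property of `A`. -/
theorem exists_algHom (hq₀ : q ≠ 0) {B : Type*} [Ring B] [Algebra ℂ B] {X Y E : B}
    (h₁₃ : X * Y = q ^ (-2 : ℤ) • (Y * X)) (h₁₂ : X * E = Y + q ^ 2 • (E * X))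
    (h₂₃ : E * Y = algebraMap ℂ B α + q ^ 2 • (Y * E))
    (hquad : ((1 - q ^ (-4 : ℤ)) * (1 - q ^ (-2 : ℤ))) • (Y * X * E)
      + (q ^ (-4 : ℤ) * (1 - q ^ (-2 : ℤ))) • Y ^ 2
      + ((1 - q ^ (-4 : ℤ)) * α) • X = algebraMap ℂ B β) :
    ∃ ρ : A q α β →ₐ[ℂ] B,
      ρ (x₁ q α β) = X ∧ ρ (x₂ q α β) = E ∧ ρ (x₃ q α β) = Y := by
  have hY : Y = X * E - q ^ 2 • (E * X) := by rw [h₁₂]; abel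
  have hz : E * Y - q ^ 2 • (Y * E) = algebraMap ℂ B α := by rw [h₂₃]; abel
  let φ : FreeAlgebra ℂ (Fin 2) →ₐ[ℂ] B := FreeAlgebra.lift ℂ ![X, E]
  have φ₀ : φ (FreeAlgebra.ι ℂ 0) = X := by simp [φ]
  have φ₁ : φ (FreeAlgebra.ι ℂ 1) = E := by simp [φ]
  have hφ : ∀ ⦃x y⦄, SerreRel q x y → φ x = φ y := by
    rintro _ _ (⟨_, _, rfl, rfl⟩ | ⟨_, _, rfl, rfl⟩)
    · simp only [map_add, map_sub, map_mul, map_smul, map_pow, map_zero, φ₀, φ₁]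
      rw [← sub_eq_zero, hY] at h₁₃
      rw [← h₁₃]
      simp only [mul_sub, sub_mul, mul_smul_comm, smul_mul_assoc, pow_two X, mul_assoc]
      match_scalars <;> field_simp <;> ring
    · simp only [map_add, map_sub, map_mul, map_smul, map_pow, map_zero, φ₀, φ₁]
      -- The second Serre relation is `-q⁻²` times the commutator of `e₂` and `z`, which vanishes
      -- since `z` becomes a scalar.
      have hc : E * (E * Y - q ^ 2 • (Y * E)) - (E * Y - q ^ 2 • (Y * E)) * E = 0 := by
        rw [hz, Algebra.commutes, sub_self]
      rw [hY] at hc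
      have hc' : -(q ^ (-2 : ℤ)) • (E * (E * (X * E - q ^ 2 • (E * X))
          - q ^ 2 • ((X * E - q ^ 2 • (E * X)) * E))
          - (E * (X * E - q ^ 2 • (E * X)) - q ^ 2 • ((X * E - q ^ 2 • (E * X)) * E)) * E) = 0 := by
        rw [hc, smul_zero]
      rw [← hc']
      simp only [mul_sub, sub_mul, mul_smul_comm, smul_mul_assoc, pow_succ E,
        pow_zero, one_mul, mul_assoc]
      match_scalars <;> field_simp <;> ring
  let ψ : UPlus q →ₐ[ℂ] B := RingQuot.liftAlgHom ℂ ⟨φ, hφ⟩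
  have ψ₁ : ψ (e₁ q) = X := by
    simp only [ψ, e₁, RingQuot.liftAlgHom_mkAlgHom_apply, φ₀]
  have ψ₂ : ψ (e₂ q) = E := by
    simp only [ψ, e₂, RingQuot.liftAlgHom_mkAlgHom_apply, φ₁]
  have ψ₃ : ψ (e₃ q) = Y := by
    rw [e₃, map_sub, map_smul, map_mul, map_mul, ψ₁, ψ₂, hY]
  have ψz : ψ (z q) = algebraMap ℂ B α := by
    rw [z, map_sub, map_smul, map_mul, map_mul, ψ₂, ψ₃, hz]
  have hψ : ∀ ⦃x y⦄, CentralRel q α β x y → ψ x = ψ y := by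
    rintro _ _ (_ | _)
    · rw [map_sub, ψz, AlgHom.commutes, sub_self, map_zero]
    · rw [map_sub, map_zero, sub_eq_zero, AlgHom.commutes, ← hquad, zPrime]
      simp only [map_add, map_mul, map_smul, map_pow, ψ₁, ψ₂, ψ₃, ψz, ← Algebra.smul_def, smul_smul]
  refine ⟨RingQuot.liftAlgHom ℂ ⟨ψ, hψ⟩, ?_, ?_, ?_⟩
  · rw [x₁, toA, RingQuot.liftAlgHom_mkAlgHom_apply, ψ₁]
  · rw [x₂, toA, RingQuot.liftAlgHom_mkAlgHom_apply, ψ₂]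
  · rw [x₃, toA, RingQuot.liftAlgHom_mkAlgHom_apply, ψ₃]

/-! ### A spanning family of `A`. -/

/-- The spanning family `x₁ ^ i * x₃ ^ ε * x₂ ^ k` of `A`, with `ε ∈ {0, 1}`. -/
def spanningMonomial (q α β : ℂ) (t : ℕ × Fin 2 × ℕ) : A q α β :=
  x₁ q α β ^ t.1 * (x₃ q α β ^ (t.2.1 : ℕ) * x₂ q α β ^ t.2.2)

theorem x₂_mul_x₁_pow (hq₀ : q ≠ 0) (i : ℕ) : ∃ r : ℂ, x₂ q α β * x₁ q α β ^ (i + 1) =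
    q ^ (-2 * (i + 1) : ℤ) • (x₁ q α β ^ (i + 1) * x₂ q α β)
      + r • (x₁ q α β ^ i * x₃ q α β) := by
  have h : x₂ q α β * x₁ q α β = q ^ (-2 : ℤ) • (x₁ q α β * x₂ q α β)
      + (-q ^ (-2 : ℤ)) • x₃ q α β := by
    rw [x₁_mul_x₂, smul_add, smul_smul]
    have hqq : q ^ (-2 : ℤ) * q ^ 2 = 1 := by
      rw [← zpow_natCast, ← zpow_add₀ hq₀]; simp
    rw [hqq]; module
  have h31 : x₃ q α β * x₁ q α β = q ^ (2 : ℤ) • (x₁ q α β * x₃ q α β) := by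
    rw [x₁_mul_x₃ hq₀, smul_smul, ← zpow_add₀ hq₀]; simp
  induction i with
  | zero => exact ⟨-q ^ (-2 : ℤ), by simpa using h⟩
  | succ i ih =>
    obtain ⟨r, hr⟩ := ih
    refine ⟨q ^ (-2 * (i + 1) : ℤ) * (-q ^ (-2 : ℤ)) + r * q ^ (2 : ℤ), ?_⟩
    have e₁ : x₁ q α β ^ (i + 1) * x₂ q α β * x₁ q α β =
        q ^ (-2 : ℤ) • (x₁ q α β ^ (i + 2) * x₂ q α β)
          + (-q ^ (-2 : ℤ)) • (x₁ q α β ^ (i + 1) * x₃ q α β) := by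
      rw [mul_assoc, h, mul_add, mul_smul_comm, mul_smul_comm, ← mul_assoc, ← pow_succ]
    have e₂ : x₁ q α β ^ i * x₃ q α β * x₁ q α β =
        q ^ (2 : ℤ) • (x₁ q α β ^ (i + 1) * x₃ q α β) := by
      rw [mul_assoc, h31, mul_smul_comm, ← mul_assoc, ← pow_succ]
    have e₃ : q ^ (-2 * ((i + 1 : ℕ) + 1) : ℤ) = q ^ (-2 * (i + 1) : ℤ) * q ^ (-2 : ℤ) := by
      rw [← zpow_add₀ hq₀]; congr 1
    rw [pow_succ _ (i + 1), ← mul_assoc, hr, add_mul, smul_mul_assoc, smul_mul_assoc, e₁, e₂, e₃,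
      ← pow_succ]
    module

/-- The span contains 1 and is stable under left multiplication by `x₁` and `x₂`, which generate
`A`. Moving `x₂` past `x₁ ^ (i + 1)` may create `x₃ ^ 2`, which the quadratic relation eliminates.
-/
theorem spanningMonomial_span (hq₀ : q ≠ 0) (hq : ∀ n : ℕ, 0 < n → q ^ n ≠ 1) :
    Submodule.span ℂ (Set.range (spanningMonomial q α β)) = ⊤ := by
  set S := Submodule.span ℂ (Set.range (spanningMonomial q α β)) with hS
  have m₀ : ∀ i k, x₁ q α β ^ i * x₂ q α β ^ k ∈ S := fun i k =>
    Submodule.subset_span ⟨(i, 0, k), by simp [spanningMonomial]⟩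
  have m₁ : ∀ i k, x₁ q α β ^ i * (x₃ q α β * x₂ q α β ^ k) ∈ S := fun i k =>
    Submodule.subset_span ⟨(i, 1, k), by simp [spanningMonomial]⟩
  have h31 : x₃ q α β * x₁ q α β = q ^ (2 : ℤ) • (x₁ q α β * x₃ q α β) := by
    rw [x₁_mul_x₃ hq₀, smul_smul, ← zpow_add₀ hq₀]; simp
  have hsq : ∃ r s t : ℂ, x₃ q α β * x₃ q α β =
      r • (x₁ q α β * (x₃ q α β * x₂ q α β)) + s • x₁ q α β + t • 1 := by
    have hq2 : (1 - q ^ (-2 : ℤ)) ≠ 0 := by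
      rw [sub_ne_zero]
      intro h
      refine hq 2 two_pos ?_
      rw [zpow_neg, eq_comm, inv_eq_one] at h
      exact_mod_cast h
    have ha : q ^ (-4 : ℤ) * (1 - q ^ (-2 : ℤ)) ≠ 0 := mul_ne_zero (zpow_ne_zero _ hq₀) hq2
    have h := quadratic_relation (q := q) (α := α) (β := β)
    rw [h31, smul_mul_assoc, smul_smul, mul_assoc (x₁ q α β), Algebra.algebraMap_eq_smul_one, pow_two] at h
    refine ⟨-((q ^ (-4 : ℤ) * (1 - q ^ (-2 : ℤ)))⁻¹ *
      ((1 - q ^ (-4 : ℤ)) * (1 - q ^ (-2 : ℤ)) * q ^ (2 : ℤ))),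
      -((q ^ (-4 : ℤ) * (1 - q ^ (-2 : ℤ)))⁻¹ * ((1 - q ^ (-4 : ℤ)) * α)),
      (q ^ (-4 : ℤ) * (1 - q ^ (-2 : ℤ)))⁻¹ * β, ?_⟩
    rw [mul_smul _ β, ← h, smul_add, smul_add, smul_smul _ _ (x₃ q α β * x₃ q α β),
      inv_mul_cancel₀ ha]
    module
  have m₂ : ∀ i k, x₁ q α β ^ i * (x₃ q α β * x₃ q α β * x₂ q α β ^ k) ∈ S := by
    intro i k
    obtain ⟨r, s, t, h⟩ := hsq
    have : x₁ q α β ^ i * (x₃ q α β * x₃ q α β * x₂ q α β ^ k) =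
        r • (x₁ q α β ^ (i + 1) * (x₃ q α β * x₂ q α β ^ (k + 1)))
        + s • (x₁ q α β ^ (i + 1) * x₂ q α β ^ k) + t • (x₁ q α β ^ i * x₂ q α β ^ k) := by
      rw [h, pow_succ _ i, pow_succ' _ k]
      simp only [add_mul, mul_add, smul_mul_assoc, mul_smul_comm, mul_assoc, one_mul]
    rw [this]
    exact S.add_mem (S.add_mem (S.smul_mem _ (m₁ _ _)) (S.smul_mem _ (m₀ _ _)))
      (S.smul_mem _ (m₀ _ _))
  have c₁ : ∀ s ∈ S, x₁ q α β * s ∈ S := by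
    intro s hs
    induction hs using Submodule.span_induction with
    | mem s hs =>
      obtain ⟨t, rfl⟩ := hs
      exact Submodule.subset_span ⟨(t.1 + 1, t.2), by
        simp [spanningMonomial, pow_succ', mul_assoc]⟩
    | zero => simp
    | add s t _ _ hs ht => rw [mul_add]; exact S.add_mem hs ht
    | smul c s _ hs => rw [mul_smul_comm]; exact S.smul_mem _ hs
  have n₁ : ∀ i k, x₁ q α β ^ i * (x₂ q α β * (x₃ q α β * x₂ q α β ^ k)) ∈ S := by
    intro i k
    rw [← mul_assoc (x₂ q α β), x₂_mul_x₃, add_mul, mul_add, ← Algebra.smul_def, smul_mul_assoc,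
      mul_smul_comm, mul_smul_comm, mul_assoc (x₃ q α β), ← pow_succ']
    exact S.add_mem (S.smul_mem _ (m₀ _ _)) (S.smul_mem _ (m₁ _ _))
  have c₂ : ∀ s ∈ S, x₂ q α β * s ∈ S := by
    intro s hs
    induction hs using Submodule.span_induction with
    | mem s hs =>
      obtain ⟨⟨i, ε, k⟩, rfl⟩ := hs
      rcases i with _ | i
      · fin_cases ε
        · simpa [spanningMonomial, pow_succ'] using m₀ 0 (k + 1)
        · simpa [spanningMonomial] using n₁ 0 k
      · obtain ⟨r, hr⟩ := x₂_mul_x₁_pow (q := q) (α := α) (β := β) hq₀ i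
        simp only [spanningMonomial]
        rw [← mul_assoc, hr, add_mul, smul_mul_assoc, smul_mul_assoc, mul_assoc, mul_assoc]
        refine S.add_mem (S.smul_mem _ ?_) (S.smul_mem _ ?_)
        · fin_cases ε
          · simpa [pow_succ'] using m₀ (i + 1) (k + 1)
          · simpa using n₁ (i + 1) k
        · fin_cases ε
          · simpa using m₁ i k
          · simpa [mul_assoc] using m₂ i k
    | zero => simp
    | add s t _ _ hs ht => rw [mul_add]; exact S.add_mem hs ht
    | smul c s _ hs => rw [mul_smul_comm]; exact S.smul_mem _ hs
  have key : ∀ a : A q α β, ∀ s ∈ S, a * s ∈ S := by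
    refine A_induction c₁ c₂ ?_ ?_ ?_
    · intro c s hs
      rw [← Algebra.smul_def]; exact S.smul_mem _ hs
    · intro a b ha hb s hs
      rw [add_mul]; exact S.add_mem (ha s hs) (hb s hs)
    · intro a b ha hb s hs
      rw [mul_assoc]; exact ha _ (hb s hs)
  refine (Submodule.eq_top_iff').2 fun a => ?_
  simpa using key a 1 (by simpa using m₀ 0 0)

end Relations

/-! ### Extreme terms of powers of `e₂`, and linear independence. -/

/-- The operator by which `e₂` acts on the quantum torus. -/
def e₂Op (q b₁ b₂ b₃ : ℂ) : Module.End ℂ TorusSpace :=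
  b₁ • monomialOp q (-1, -1) + b₂ • monomialOp q (-1, 1) + b₃ • monomialOp q (0, -1)

section Leading

variable {q b₁ b₂ b₃ : ℂ}

theorem e₂Op_apply (v : TorusSpace) (m n : ℤ) :
    e₂Op q b₁ b₂ b₃ v (m, n) = b₁ * (q ^ (2 * -1 * (m + 1)) * v (m + 1, n + 1))
      + b₂ * (q ^ (2 * 1 * (m + 1)) * v (m + 1, n - 1))
      + b₃ * (q ^ (2 * -1 * m) * v (m, n + 1)) := by
  simp [e₂Op, monomialOp_apply]

/-- The element of the quantum torus which is the image of `e₂ ^ k`. -/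
def e₂Pow (q b₁ b₂ b₃ : ℂ) (k : ℕ) : TorusSpace :=
  (e₂Op q b₁ b₂ b₃ ^ k) (Finsupp.single 0 1)

theorem e₂Pow_zero_apply (m n : ℤ) :
    e₂Pow q b₁ b₂ b₃ 0 (m, n) = if m = 0 ∧ n = 0 then 1 else 0 := by
  simp [e₂Pow, Finsupp.single_apply, Prod.ext_iff, eq_comm]

theorem e₂Pow_succ_apply (k : ℕ) (m n : ℤ) :
    e₂Pow q b₁ b₂ b₃ (k + 1) (m, n) =
      b₁ * (q ^ (2 * -1 * (m + 1)) * e₂Pow q b₁ b₂ b₃ k (m + 1, n + 1))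
      + b₂ * (q ^ (2 * 1 * (m + 1)) * e₂Pow q b₁ b₂ b₃ k (m + 1, n - 1))
      + b₃ * (q ^ (2 * -1 * m) * e₂Pow q b₁ b₂ b₃ k (m, n + 1)) := by
  rw [e₂Pow, pow_succ', Module.End.mul_apply, ← e₂Pow, e₂Op_apply]

theorem e₂Pow_eq_zero_of_lt (k : ℕ) (m n : ℤ) (h : k < n ∨ n < -k) :
    e₂Pow q b₁ b₂ b₃ k (m, n) = 0 := by
  induction k generalizing m n with
  | zero => rw [e₂Pow_zero_apply, if_neg]; omega
  | succ k ih =>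
    rw [e₂Pow_succ_apply, ih _ (n + 1) (by push_cast at h; omega),
      ih _ (n + 1) (by push_cast at h; omega), ih _ (n - 1) (by push_cast at h; omega)]
    simp

/-- Only the `b₂` term raises the second exponent, so the top row comes from its `k`-th power alone.
-/
theorem e₂Pow_top_eq_zero (k : ℕ) (m : ℤ) (h : m ≠ -k) : e₂Pow q b₁ b₂ b₃ k (m, k) = 0 := by
  induction k generalizing m with
  | zero => rw [e₂Pow_zero_apply, if_neg]; push_cast at h; omega
  | succ k ih =>
    push_cast at h ⊢
    rw [e₂Pow_succ_apply, e₂Pow_eq_zero_of_lt k _ (k + 1 + 1) (by omega),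
      e₂Pow_eq_zero_of_lt k _ (k + 1 + 1) (by omega), add_sub_cancel_right, ih _ (by omega)]
    simp

theorem e₂Pow_top_ne_zero (hq₀ : q ≠ 0) (hb₂ : b₂ ≠ 0) (k : ℕ) :
    e₂Pow q b₁ b₂ b₃ k (-k, k) ≠ 0 := by
  induction k with
  | zero => simp [e₂Pow_zero_apply]
  | succ k ih =>
    push_cast
    rw [e₂Pow_succ_apply, e₂Pow_eq_zero_of_lt k _ (k + 1 + 1) (by omega),
      e₂Pow_eq_zero_of_lt k _ (k + 1 + 1) (by omega), add_sub_cancel_right,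
      show -((k : ℤ) + 1) + 1 = -k by ring]
    simp [hb₂, ih, zpow_ne_zero _ hq₀]

open Classical in
/-- The slope of the lowest term of the powers of `e₂` in the quantum torus. -/
def slope (b₁ : ℂ) : ℤ := if b₁ = 0 then 0 else 1

/-- The bottom row comes from the `b₁` and `b₃` terms. Its leftmost entry uses only the `b₁` term if
`b₁ ≠ 0`, and only the `b₃` term otherwise. -/
theorem e₂Pow_bottom_eq_zero (k : ℕ) (m : ℤ) (h : m < -(slope b₁ * k)) :
    e₂Pow q b₁ b₂ b₃ k (m, -k) = 0 := by
  induction k generalizing m with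
  | zero => rw [e₂Pow_zero_apply, if_neg]; simp at h; omega
  | succ k ih =>
    push_cast at h ⊢
    rw [e₂Pow_succ_apply, e₂Pow_eq_zero_of_lt k _ (-(k + 1 : ℤ) - 1) (by omega),
      show -((k : ℤ) + 1) + 1 = -k by ring]
    by_cases hb : b₁ = 0
    · subst hb
      simp only [slope, if_true] at h ih
      rw [ih m (by omega)]
      simp
    · simp only [slope, hb, if_false] at h ih
      rw [ih m (by omega), ih (m + 1) (by omega)]
      simp

theorem e₂Pow_bottom_ne_zero (hq₀ : q ≠ 0) (hb : b₁ ≠ 0 ∨ b₃ ≠ 0) (k : ℕ) :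
    e₂Pow q b₁ b₂ b₃ k (-(slope b₁ * k), -k) ≠ 0 := by
  induction k with
  | zero => simp [e₂Pow_zero_apply]
  | succ k ih =>
    push_cast
    rw [e₂Pow_succ_apply, e₂Pow_eq_zero_of_lt k _ (-(k + 1 : ℤ) - 1) (by omega),
      show -((k : ℤ) + 1) + 1 = -k by ring]
    by_cases hb' : b₁ = 0
    · subst hb'
      have hb₃ : b₃ ≠ 0 := by simpa using hb
      simp only [slope, if_true, zero_mul, neg_zero] at ih ⊢
      simp [hb₃, ih]
    · rw [e₂Pow_bottom_eq_zero k (-(slope b₁ * (k + 1))) (by simp [slope, hb'])]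
      simp only [slope, hb', if_false] at ih ⊢
      rw [show -(1 * ((k : ℤ) + 1)) + 1 = -(1 * k) by ring]
      simp only [mul_zero, add_zero]
      exact mul_ne_zero hb' (mul_ne_zero (zpow_ne_zero _ hq₀) ih)

/-- The image of the spanning family in the quantum torus. -/
def torusMonomial (q b₁ b₂ b₃ : ℂ) (t : ℕ × Fin 2 × ℕ) : TorusSpace :=
  (monomialOp q (1, 0) ^ t.1 * (monomialOp q (0, 1) ^ (t.2.1 : ℕ) * e₂Op q b₁ b₂ b₃ ^ t.2.2))
    (Finsupp.single 0 1)

theorem monomialOp_pow_apply (i : ℕ) (v : TorusSpace) (m n : ℤ) :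
    (monomialOp q (1, 0) ^ i) v (m, n) = v (m - i, n) := by
  induction i generalizing m with
  | zero => simp
  | succ i ih =>
    rw [pow_succ', Module.End.mul_apply, monomialOp_apply]
    simp [ih, sub_sub, add_comm]

theorem torusMonomial_apply_zero (i k : ℕ) (m n : ℤ) :
    torusMonomial q b₁ b₂ b₃ (i, 0, k) (m, n) = e₂Pow q b₁ b₂ b₃ k (m - i, n) := by
  simp [torusMonomial, monomialOp_pow_apply, e₂Pow]

theorem torusMonomial_apply_one (i k : ℕ) (m n : ℤ) :
    torusMonomial q b₁ b₂ b₃ (i, 1, k) (m, n) =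
      q ^ (2 * (m - i)) * e₂Pow q b₁ b₂ b₃ k (m - i, n - 1) := by
  simp [torusMonomial, monomialOp_pow_apply, e₂Pow, monomialOp_apply]

theorem linearIndependent_torusMonomial (hq₀ : q ≠ 0) (hb₂ : b₂ ≠ 0) (hb : b₁ ≠ 0 ∨ b₃ ≠ 0) :
    LinearIndependent ℂ (torusMonomial q b₁ b₂ b₃) := by
  rw [linearIndependent_iff]
  intro l hl
  by_contra hne
  obtain ⟨t₀, ht₀, hmax⟩ := Finset.exists_max_image l.support (fun t => t.2.2)
    (Finsupp.support_nonempty_iff.2 hne)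
  set N := t₀.2.2
  have hev : ∀ m n, l.sum (fun t c => c * torusMonomial q b₁ b₂ b₃ t (m, n)) = 0 := by
    intro m n
    have := DFunLike.congr_fun hl (m, n)
    simpa [Finsupp.linearCombination_apply, Finsupp.sum, Finsupp.finsetSum_apply] using this
  -- Row `N + 1` is reached only with `ε = 1` and `k = N`, and there each `i` occupies its own
  -- column.
  have h₁ : ∀ i, l (i, 1, N) = 0 := by
    intro i
    have := hev (i - N) (N + 1)
    rw [Finsupp.sum, Finset.sum_eq_single (i, 1, N)] at this
    · rw [torusMonomial_apply_one, add_sub_cancel_right, sub_right_comm, sub_self, zero_sub] at this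
      simpa [e₂Pow_top_ne_zero hq₀ hb₂, hq₀, zpow_ne_zero] using this
    · rintro ⟨i', ε, k⟩ ht hne'
      have hk : k ≤ N := hmax _ ht
      fin_cases ε
      · simp only [Fin.zero_eta, torusMonomial_apply_zero]
        rw [e₂Pow_eq_zero_of_lt _ _ _ (by omega), mul_zero]
      · simp only [Fin.mk_one, torusMonomial_apply_one]
        rcases hk.lt_or_eq with hk | rfl
        · rw [e₂Pow_eq_zero_of_lt _ _ _ (by omega), mul_zero, mul_zero]
        · have : i' ≠ i := by rintro rfl; exact hne' rfl
          rw [add_sub_cancel_right, e₂Pow_top_eq_zero _ _ (by omega), mul_zero, mul_zero]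
    · intro h
      rw [Finsupp.notMem_support_iff.1 h, zero_mul]
  have hex : ∃ i, l (i, 0, N) ≠ 0 := by
    obtain ⟨i, ε, k⟩ := t₀
    fin_cases ε
    · exact ⟨i, Finsupp.mem_support_iff.1 ht₀⟩
    · exact absurd (h₁ i) (Finsupp.mem_support_iff.1 ht₀)
  classical
  have hmin := fun i => Nat.find_min' hex (m := i)
  have hi := Nat.find_spec hex
  set i₀ := Nat.find hex
  -- Row `-N` is reached only with `ε = 0` and `k = N`. Since `i₀` is minimal, its leftmost entry
  -- there cannot be cancelled.
  have := hev (i₀ - slope b₁ * N) (-N)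
  rw [Finsupp.sum, Finset.sum_eq_single (i₀, 0, N)] at this
  · rw [torusMonomial_apply_zero, sub_right_comm, sub_self, zero_sub] at this
    exact mul_ne_zero hi (e₂Pow_bottom_ne_zero hq₀ hb N) this
  · rintro ⟨i, ε, k⟩ ht hne'
    have hk : k ≤ N := hmax _ ht
    fin_cases ε
    · simp only [Fin.zero_eta, torusMonomial_apply_zero]
      rcases hk.lt_or_eq with hk | rfl
      · rw [e₂Pow_eq_zero_of_lt _ _ _ (by omega), mul_zero]
      · have h1 : i₀ ≤ i := hmin i (Finsupp.mem_support_iff.1 ht)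
        have : i ≠ i₀ := by rintro rfl; exact hne' rfl
        rw [e₂Pow_bottom_eq_zero _ _ (by omega), mul_zero]
    · simp only [Fin.mk_one, torusMonomial_apply_one]
      rw [e₂Pow_eq_zero_of_lt _ _ _ (by omega), mul_zero, mul_zero]
  · intro h
    rw [Finsupp.notMem_support_iff.1 h, zero_mul]

end Leading

/-! ### The faithful representation on the quantum torus. -/

theorem pow_sub_one_ne_zero {q : ℂ} (hq : ∀ n : ℕ, 0 < n → q ^ n ≠ 1) {n : ℕ} (hn : 0 < n) :
    q ^ n - 1 ≠ 0 :=
  sub_ne_zero.2 (hq n hn)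

theorem one_sub_zpow_ne_zero {q : ℂ} (hq : ∀ n : ℕ, 0 < n → q ^ n ≠ 1) {n : ℕ} (hn : 0 < n) :
    1 - q ^ (-(n : ℤ)) ≠ 0 := by
  rw [sub_ne_zero]
  intro h
  rw [zpow_neg, eq_comm, inv_eq_one] at h
  exact hq n hn (by exact_mod_cast h)

/-- The action of `A` on the quantum torus by left multiplication. -/
theorem exists_torusRep {q : ℂ} (hq₀ : q ≠ 0) (hq : ∀ n : ℕ, 0 < n → q ^ n ≠ 1) (α β : ℂ) :
    ∃ ρ : A q α β →ₐ[ℂ] Module.End ℂ TorusSpace,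
      ρ (x₁ q α β) = monomialOp q (1, 0) ∧
      ρ (x₂ q α β) = e₂Op q (β / ((1 - q ^ (-4 : ℤ)) * (1 - q ^ (-2 : ℤ)))) (-(q ^ 4 - 1)⁻¹)
        (-(α / (q ^ 2 - 1))) ∧
      ρ (x₃ q α β) = monomialOp q (0, 1) := by
  have h4 : 1 - q ^ (-4 : ℤ) ≠ 0 := one_sub_zpow_ne_zero hq (n := 4) (by norm_num)
  have h2 : 1 - q ^ (-2 : ℤ) ≠ 0 := one_sub_zpow_ne_zero hq (n := 2) (by norm_num)
  have h4' : q ^ 4 - 1 ≠ 0 := pow_sub_one_ne_zero hq (by norm_num)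
  have h2' : q ^ 2 - 1 ≠ 0 := pow_sub_one_ne_zero hq (by norm_num)
  have e4 : q ^ (-4 : ℤ) = (q ^ 4)⁻¹ := by rw [zpow_neg]; norm_cast
  have e2 : q ^ (-2 : ℤ) = (q ^ 2)⁻¹ := by rw [zpow_neg]; norm_cast
  have e4' : 1 - (q ^ 4)⁻¹ = (q ^ 4 - 1) * (q ^ 4)⁻¹ := by field_simp
  have e2' : 1 - (q ^ 2)⁻¹ = (q ^ 2 - 1) * (q ^ 2)⁻¹ := by field_simp
  refine exists_algHom (B := Module.End ℂ TorusSpace) hq₀ ?_ ?_ ?_ ?_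
  · simp only [monomialOp_mul hq₀, Prod.mk_add_mk, smul_smul]
    norm_num [e2, hq₀]
  · simp only [e₂Op, mul_add, add_mul, smul_mul_assoc, mul_smul_comm, monomialOp_mul hq₀,
      Prod.mk_add_mk, smul_smul]
    norm_num
    match_scalars <;> field_simp <;> ring
  · simp only [e₂Op, mul_add, add_mul, smul_mul_assoc, mul_smul_comm, monomialOp_mul hq₀,
      Prod.mk_add_mk, smul_smul, Algebra.algebraMap_eq_smul_one, ← monomialOp_zero q]
    rw [← Prod.mk_zero_zero]
    norm_num
    match_scalars <;> field_simp <;> ring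
  · rw [e4, e2, e4', e2']
    simp only [e₂Op, pow_two (monomialOp _ _), mul_add, add_mul, smul_mul_assoc, mul_smul_comm,
      monomialOp_mul hq₀, Prod.mk_add_mk, smul_smul, Algebra.algebraMap_eq_smul_one,
      ← monomialOp_zero q]
    rw [← Prod.mk_zero_zero]
    norm_num
    match_scalars <;> field_simp <;> ring

section Rep

variable {q α β b₁ b₂ b₃ : ℂ} {ρ : A q α β →ₐ[ℂ] Module.End ℂ TorusSpace}

theorem torusRep_injective (hq₀ : q ≠ 0) (hq : ∀ n : ℕ, 0 < n → q ^ n ≠ 1)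
    (hb₂ : b₂ ≠ 0) (hb : b₁ ≠ 0 ∨ b₃ ≠ 0)
    (h₁ : ρ (x₁ q α β) = monomialOp q (1, 0)) (h₂ : ρ (x₂ q α β) = e₂Op q b₁ b₂ b₃)
    (h₃ : ρ (x₃ q α β) = monomialOp q (0, 1)) : Function.Injective ρ := by
  rw [injective_iff_map_eq_zero]
  intro a ha
  have hmem : a ∈ Submodule.span ℂ (Set.range (spanningMonomial q α β)) := by
    rw [spanningMonomial_span hq₀ hq]; trivial
  rw [← Finsupp.range_linearCombination] at hmem
  obtain ⟨l, rfl⟩ := hmem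
  have := linearIndependent_iff.1 (linearIndependent_torusMonomial (q := q) hq₀ hb₂ hb) l (by
    have h := congrArg (fun S : Module.End ℂ TorusSpace => S (Finsupp.single 0 1)) ha
    simp only [Finsupp.linearCombination_apply, Finsupp.sum, map_sum, map_smul,
      LinearMap.sum_apply, LinearMap.smul_apply, spanningMonomial, map_mul, map_pow, h₁, h₂, h₃,
      LinearMap.zero_apply] at h
    simpa only [Finsupp.linearCombination_apply, Finsupp.sum, torusMonomial] using h)
  simp [this]

theorem torusRep_mem_range (hq₀ : q ≠ 0)
    (h₁ : ρ (x₁ q α β) = monomialOp q (1, 0)) (h₂ : ρ (x₂ q α β) = e₂Op q b₁ b₂ b₃)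
    (a : A q α β) : ρ a ∈ LinearMap.range (torusOp q) := by
  have hm : ∀ g, monomialOp q g ∈ LinearMap.range (torusOp q) := fun g =>
    ⟨Finsupp.single g 1, by simp [torusOp_single]⟩
  induction a using A_induction with
  | h₁ => rw [h₁]; exact hm _
  | h₂ =>
    rw [h₂]
    exact Submodule.add_mem _ (Submodule.add_mem _ (Submodule.smul_mem _ _ (hm _))
      (Submodule.smul_mem _ _ (hm _))) (Submodule.smul_mem _ _ (hm _))
  | halg c =>
    rw [AlgHom.commutes, Algebra.algebraMap_eq_smul_one, ← monomialOp_zero q]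
    exact Submodule.smul_mem _ _ (hm _)
  | hadd a b ha hb => rw [map_add]; exact Submodule.add_mem _ ha hb
  | hmul a b ha hb => rw [map_mul]; exact mul_mem_range_torusOp hq₀ ha hb

/-- A unit of `A` acts as a multiple of a monomial. -/
theorem exists_torusRep_unit_eq (hq₀ : q ≠ 0)
    (h₁ : ρ (x₁ q α β) = monomialOp q (1, 0)) (h₂ : ρ (x₂ q α β) = e₂Op q b₁ b₂ b₃)
    (a : (A q α β)ˣ) : ∃ (g : ℤ × ℤ) (c : ℂ), c ≠ 0 ∧ ρ a = c • monomialOp q g := by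
  obtain ⟨v, hv⟩ := torusRep_mem_range hq₀ h₁ h₂ (a : A q α β)
  obtain ⟨w, hw⟩ := torusRep_mem_range hq₀ h₁ h₂ ((a⁻¹ : (A q α β)ˣ) : A q α β)
  have h : torusOp q v w = Finsupp.single 0 1 := by
    conv_lhs => rw [← torusOp_apply_one q w, ← Module.End.mul_apply, hv, hw, ← map_mul,
      Units.mul_inv, map_one]
    rfl
  obtain ⟨g, c, hc, rfl⟩ := exists_eq_single_of_torusOp_apply_eq_one hq₀ h
  exact ⟨g, c, hc, by rw [← hv, torusOp_single]⟩

/-! ### Constraints on the exponents of monomials in the image of `A`. -/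

/-- A degree bound for monomials in the image of `A`, from an invariant subspace of the
quantum torus. -/
theorem degree_le_zero
    (h₁ : ρ (x₁ q α β) = monomialOp q (1, 0)) (h₂ : ρ (x₂ q α β) = e₂Op q b₁ b₂ b₃)
    (D : ℤ × ℤ →+ ℤ) {κ : ℤ × ℤ → ℂ} {F : ℤ × ℤ → ℤ → ℂ} (hκ₀ : ∀ g, κ g ≠ 0)
    (hκ : ∀ g h, κ (g + h) * q ^ (2 * g.2 * h.1) = F g (D h) * κ h) (hD : D (1, 0) ≤ 0)
    (hE : ∀ r : ℤ → ℂ, (∀ d, 0 < d → r d = 0) → ∀ d, 0 < d →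
      b₁ * (F (-1, -1) (d - D (-1, -1)) * r (d - D (-1, -1)))
      + b₂ * (F (-1, 1) (d - D (-1, 1)) * r (d - D (-1, 1)))
      + b₃ * (F (0, -1) (d - D (0, -1)) * r (d - D (0, -1))) = 0)
    {a : A q α β} {g : ℤ × ℤ} {c : ℂ} (hc : c ≠ 0) (ha : ρ a = c • monomialOp q g) : D g ≤ 0 := by
  -- `ev` collapses the level sets of `D` with weights `κ`. By `hκ` it turns each monomial operator
  -- into a weighted shift, and `hE` says that `e₂` creates no positive degree.
  let ev : TorusSpace →ₗ[ℂ] ℤ →₀ ℂ :=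
    Finsupp.linearCombination ℂ fun h => Finsupp.single (D h) (κ h)
  have hev : ∀ h c, ev (Finsupp.single h c) = Finsupp.single (D h) (c * κ h) := by
    intro h c; simp [ev]
  have hop : ∀ g v d, ev (monomialOp q g v) d = F g (d - D g) * ev v (d - D g) := by
    intro g v d
    induction v using Finsupp.induction_linear with
    | zero => simp
    | add v w hv hw => simp only [map_add, Finsupp.add_apply, hv, hw, mul_add]
    | single h c =>
      rw [monomialOp_single, hev, hev, map_add]
      by_cases hd : D g + D h = d
      · have hd' : D h = d - D g := by omega
        rw [← hd', hd, Finsupp.single_eq_same, Finsupp.single_eq_same]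
        linear_combination c * hκ g h
      · rw [Finsupp.single_eq_of_ne' hd, Finsupp.single_eq_of_ne' (by omega), mul_zero]
  have key : ∀ a : A q α β, ∀ v, (∀ d, 0 < d → ev v d = 0) → ∀ d, 0 < d → ev (ρ a v) d = 0 := by
    refine A_induction ?_ ?_ ?_ ?_ ?_
    · intro v hv d hd
      rw [h₁, hop, hv _ (by omega), mul_zero]
    · intro v hv d hd
      rw [h₂, e₂Op]
      simpa only [LinearMap.add_apply, LinearMap.smul_apply, map_add, map_smul, Finsupp.add_apply,
        Finsupp.smul_apply, smul_eq_mul, hop] using hE _ hv d hd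
    · intro c v hv d hd
      simp [Algebra.algebraMap_eq_smul_one, hv d hd]
    · intro a b ha hb v hv d hd
      simp [ha v hv d hd, hb v hv d hd]
    · intro a b ha hb v hv d hd
      rw [map_mul, Module.End.mul_apply]
      exact ha _ (hb v hv) d hd
  by_contra! hg
  have := key a (Finsupp.single 0 1) (by
    intro d hd
    rw [hev, map_zero, Finsupp.single_eq_of_ne' hd.ne]) _ hg
  rw [ha, LinearMap.smul_apply, monomialOp_single, map_smul, hev, add_zero] at this
  simp [hc, hκ₀] at this

/-- For `D = -fst` the degree 1 part of `e₂` consists of the `b₁` and `b₂` terms. They cancel on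
degree 0 when `b₁ * y⁻¹ + b₂ * y = 0`, hence the square root. -/
theorem fst_nonneg (hb₁ : b₁ ≠ 0) (hb₂ : b₂ ≠ 0)
    (h₁ : ρ (x₁ q α β) = monomialOp q (1, 0)) (h₂ : ρ (x₂ q α β) = e₂Op q b₁ b₂ b₃)
    {a : A q α β} {g : ℤ × ℤ} {c : ℂ} (hc : c ≠ 0)
    (ha : ρ a = c • monomialOp q g) : 0 ≤ g.1 := by
  obtain ⟨y, hy⟩ := IsAlgClosed.exists_pow_nat_eq (-(b₁ / b₂)) two_pos
  have hy₀ : y ≠ 0 := by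
    rintro rfl
    simp [hb₁, hb₂] at hy
  have := degree_le_zero h₁ h₂ (-AddMonoidHom.fst ℤ ℤ) (κ := fun g => y ^ g.2)
    (F := fun g d => q ^ (-2 * g.2 * d) * y ^ g.2) (fun g => zpow_ne_zero _ hy₀) ?_ (by simp) ?_
    hc ha
  · simpa using this
  · intro g h
    simp only [Prod.snd_add, zpow_add₀ hy₀, AddMonoidHom.neg_apply, AddMonoidHom.coe_fst]
    rw [show -2 * g.2 * -h.1 = 2 * g.2 * h.1 by ring]
    ring
  · intro r hr d hd
    simp only [AddMonoidHom.neg_apply, AddMonoidHom.coe_fst]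
    rcases (show d = 1 ∨ 1 < d by omega) with rfl | hd'
    · rw [hr (1 - -0) (by norm_num)]
      norm_num
      field_simp
      field_simp at hy
      linear_combination r 0 * hy
    · rw [hr _ (by omega), hr _ (by omega)]
      simp

/-- For `D = -snd` the degree 1 part consists of the `b₁` and `b₃` terms, which cancel on degree 0
when `b₁ * x⁻¹ * q⁻² + b₃ = 0`. -/
theorem snd_nonneg (hb₁ : b₁ ≠ 0) (hb₃ : b₃ ≠ 0)
    (h₁ : ρ (x₁ q α β) = monomialOp q (1, 0)) (h₂ : ρ (x₂ q α β) = e₂Op q b₁ b₂ b₃)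
    (hq₀ : q ≠ 0) {a : A q α β} {g : ℤ × ℤ} {c : ℂ} (hc : c ≠ 0)
    (ha : ρ a = c • monomialOp q g) : 0 ≤ g.2 := by
  obtain ⟨x, hx⟩ : ∃ x, x = -(b₁ / (b₃ * q ^ 2)) := ⟨_, rfl⟩
  have hx₀ : x ≠ 0 := by simp [hx, hb₁, hb₃, hq₀]
  have := degree_le_zero h₁ h₂ (-AddMonoidHom.snd ℤ ℤ)
    (κ := fun g => x ^ g.1 * q ^ (-2 * g.1 * g.2))
    (F := fun g d => x ^ g.1 * q ^ (2 * g.1 * d - 2 * g.1 * g.2))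
    (fun g => mul_ne_zero (zpow_ne_zero _ hx₀) (zpow_ne_zero _ hq₀)) ?_ (by simp) ?_
    hc ha
  · simpa using this
  · intro g h
    simp only [Prod.snd_add, Prod.fst_add, zpow_add₀ hx₀, AddMonoidHom.neg_apply,
      AddMonoidHom.coe_snd]
    have : q ^ (-2 * (g.1 + h.1) * (g.2 + h.2)) * q ^ (2 * g.2 * h.1) =
        q ^ (2 * g.1 * -h.2 - 2 * g.1 * g.2) * q ^ (-2 * h.1 * h.2) := by
      rw [← zpow_add₀ hq₀, ← zpow_add₀ hq₀]
      congr 1; ring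
    linear_combination (x ^ g.1 * x ^ h.1) * this
  · intro r hr d hd
    simp only [AddMonoidHom.neg_apply, AddMonoidHom.coe_snd]
    rw [hr (d - -1) (by omega)]
    rcases (show d = 1 ∨ 1 < d by omega) with rfl | hd'
    · norm_num [hx]
      norm_cast
      field_simp
      simp
    · rw [hr _ (by omega)]
      simp

/-- With `b₁ = 0`, both remaining terms of `e₂` have degree 1 for `D = -(2 • fst + snd)`, and they
cancel on degree 0 when `b₂ * u + b₃ = 0`. -/
theorem two_mul_fst_add_snd_nonneg (hb₁ : b₁ = 0) (hb₂ : b₂ ≠ 0) (hb₃ : b₃ ≠ 0)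
    (h₁ : ρ (x₁ q α β) = monomialOp q (1, 0)) (h₂ : ρ (x₂ q α β) = e₂Op q b₁ b₂ b₃)
    (hq₀ : q ≠ 0) {a : A q α β} {g : ℤ × ℤ} {c : ℂ} (hc : c ≠ 0)
    (ha : ρ a = c • monomialOp q g) : 0 ≤ 2 * g.1 + g.2 := by
  obtain ⟨u, hu⟩ : ∃ u, u = -(b₃ / b₂) := ⟨_, rfl⟩
  have hu₀ : u ≠ 0 := by simp [hu, hb₂, hb₃]
  have := degree_le_zero h₁ h₂ (-(2 • AddMonoidHom.fst ℤ ℤ + AddMonoidHom.snd ℤ ℤ))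
    (κ := fun g => u ^ (-g.1) * q ^ (-2 * g.1 * (g.1 + g.2)))
    (F := fun g d => u ^ (-g.1) * q ^ (2 * g.1 * d - 2 * g.1 * (g.1 + g.2)))
    (fun g => mul_ne_zero (zpow_ne_zero _ hu₀) (zpow_ne_zero _ hq₀)) ?_ (by simp) ?_
    hc ha
  · simp at this
    omega
  · intro g h
    simp only [Prod.snd_add, Prod.fst_add, neg_add, zpow_add₀ hu₀, AddMonoidHom.neg_apply,
      AddMonoidHom.coe_snd, AddMonoidHom.coe_fst, AddMonoidHom.add_apply, AddMonoidHom.smul_apply]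
    have : q ^ (-2 * (g.1 + h.1) * (g.1 + h.1 + (g.2 + h.2))) * q ^ (2 * g.2 * h.1) =
        q ^ (2 * g.1 * (-(2 • h.1) + -h.2) - 2 * g.1 * (g.1 + g.2)) *
          q ^ (-2 * h.1 * (h.1 + h.2)) := by
      rw [← zpow_add₀ hq₀, ← zpow_add₀ hq₀]
      congr 1; simp only [nsmul_eq_mul, Nat.cast_ofNat]; ring
    linear_combination (u ^ (-g.1) * u ^ (-h.1)) * this
  · intro r hr d hd
    simp only [AddMonoidHom.neg_apply, AddMonoidHom.coe_snd, AddMonoidHom.coe_fst,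
      AddMonoidHom.add_apply, AddMonoidHom.smul_apply, hb₁, zero_mul, zero_add]
    rcases (show d = 1 ∨ 1 < d by omega) with rfl | hd'
    · norm_num [hu]
      field_simp
      simp
    · rw [hr _ (by norm_num; omega), hr _ (by norm_num; omega)]
      simp

end Rep

/-! ### Exponents of units, and transfer of invertibility to `A`. -/

/-- The operator `S` is a non-zero multiple of the monomial of exponent `g`. -/
def IsMonomial (q : ℂ) (S : Module.End ℂ TorusSpace) (g : ℤ × ℤ) : Prop :=
  ∃ c : ℂ, c ≠ 0 ∧ S = c • monomialOp q g

section IsMonomial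

variable {q : ℂ} {S T : Module.End ℂ TorusSpace} {g h : ℤ × ℤ}

theorem isMonomial_monomialOp (q : ℂ) (g : ℤ × ℤ) : IsMonomial q (monomialOp q g) g :=
  ⟨1, one_ne_zero, (one_smul _ _).symm⟩

theorem isMonomial_one (q : ℂ) : IsMonomial q 1 0 := by
  rw [← monomialOp_zero q]; exact isMonomial_monomialOp q 0

theorem IsMonomial.mul (hq₀ : q ≠ 0) (hS : IsMonomial q S g) (hT : IsMonomial q T h) :
    IsMonomial q (S * T) (g + h) := by
  obtain ⟨c, hc, rfl⟩ := hS
  obtain ⟨d, hd, rfl⟩ := hT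
  refine ⟨c * d * q ^ (2 * g.2 * h.1), mul_ne_zero (mul_ne_zero hc hd) (zpow_ne_zero _ hq₀), ?_⟩
  rw [smul_mul_smul_comm, monomialOp_mul hq₀, smul_smul]

theorem IsMonomial.unique (hg : IsMonomial q S g) (hh : IsMonomial q S h) : g = h := by
  obtain ⟨c, hc, rfl⟩ := hg
  obtain ⟨d, hd, H⟩ := hh
  exact monomialOp_smul_injective hc H

theorem isUnit_monomialOp (hq₀ : q ≠ 0) (g : ℤ × ℤ) : IsUnit (monomialOp q g) := by
  have h : ∀ k, ∃ d : ℂ, monomialOp q k * (d • monomialOp q (-k)) = 1 ∧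
      (d • monomialOp q (-k)) * monomialOp q k = 1 := by
    intro k
    refine ⟨q ^ (2 * k.2 * k.1), ?_, ?_⟩ <;>
    simp only [smul_mul_assoc, mul_smul_comm, monomialOp_mul hq₀, smul_smul, add_neg_cancel,
      neg_add_cancel, monomialOp_zero] <;>
    rw [← zpow_add₀ hq₀] <;> simp
  obtain ⟨d, h₁, h₂⟩ := h g
  exact ⟨⟨_, _, h₁, h₂⟩, rfl⟩

end IsMonomial

section Units

variable {q α β : ℂ} {ρ : A q α β →ₐ[ℂ] Module.End ℂ TorusSpace}

theorem IsMonomial.zpow (hq₀ : q ≠ 0) (hunit : ∀ a : (A q α β)ˣ, ∃ g, IsMonomial q (ρ a) g)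
    {w : (A q α β)ˣ} {g : ℤ × ℤ} (hw : IsMonomial q (ρ w) g) (n : ℤ) :
    IsMonomial q (ρ (w ^ n : (A q α β)ˣ)) (n • g) := by
  have hinv : IsMonomial q (ρ (w⁻¹ : (A q α β)ˣ)) (-g) := by
    obtain ⟨h, hh⟩ := hunit w⁻¹
    have := hw.mul hq₀ hh
    rw [← map_mul, Units.mul_inv, map_one] at this
    rwa [neg_eq_of_add_eq_zero_right (this.unique (isMonomial_one q))]
  induction n using Int.induction_on with
  | zero => simpa using isMonomial_one q
  | succ n ih =>
    rw [zpow_add_one, Units.val_mul, map_mul, add_smul, one_smul]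
    exact ih.mul hq₀ hw
  | pred n ih =>
    rw [zpow_sub_one, Units.val_mul, map_mul, sub_smul, one_smul, sub_eq_add_neg]
    exact ih.mul hq₀ hinv

theorem eq_algebraMap_of_isMonomial_zero (hρ : Function.Injective ρ) {a : A q α β}
    (ha : IsMonomial q (ρ a) 0) : ∃ c : ℂ, c ≠ 0 ∧ a = algebraMap ℂ _ c := by
  obtain ⟨c, hc, h⟩ := ha
  refine ⟨c, hc, hρ ?_⟩
  rw [h, AlgHom.commutes, monomialOp_zero, Algebra.algebraMap_eq_smul_one]

/-- If the exponents of all units are multiples of that of `w`, then the units are the non-zero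
multiples of the powers of `w`. -/
theorem setOf_isUnit_eq (hq₀ : q ≠ 0) (hρ : Function.Injective ρ)
    (hunit : ∀ a : (A q α β)ˣ, ∃ g, IsMonomial q (ρ a) g)
    {w : (A q α β)ˣ} {g : ℤ × ℤ} (hw : IsMonomial q (ρ w) g)
    (hg : ∀ (a : (A q α β)ˣ) h, IsMonomial q (ρ a) h → ∃ n : ℤ, h = n • g) :
    {a : A q α β | IsUnit a} =
      {a | ∃ (c : ℂ) (i : ℤ), c ≠ 0 ∧ a = c • ((w ^ i : (A q α β)ˣ) : A q α β)} := by
  ext a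
  constructor
  · rintro ⟨a, rfl⟩
    obtain ⟨h, hh⟩ := hunit a
    obtain ⟨n, rfl⟩ := hg a h hh
    have := hh.mul hq₀ (hw.zpow hq₀ hunit (-n))
    rw [neg_smul, add_neg_cancel, ← map_mul] at this
    obtain ⟨c, hc, h⟩ := eq_algebraMap_of_isMonomial_zero hρ this
    refine ⟨c, n, hc, ?_⟩
    rw [Algebra.smul_def, ← h, mul_assoc, ← Units.val_mul, ← zpow_add]
    simp
  · rintro ⟨c, i, hc, rfl⟩
    rw [Set.mem_ofPred_eq, Algebra.smul_def]
    exact ((IsUnit.mk0 c hc).map (algebraMap ℂ _)).mul (Units.isUnit _)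

/-- Both products of `a` and `b` act as non-zero scalars, hence are such scalars in `A` by
faithfulness. -/
theorem isUnit_of_isMonomial (hq₀ : q ≠ 0) (hρ : Function.Injective ρ) {a b : A q α β}
    {g : ℤ × ℤ} (ha : IsMonomial q (ρ a) g) (hb : IsMonomial q (ρ b) (-g)) : IsUnit a := by
  have hab := ha.mul hq₀ hb
  have hba := hb.mul hq₀ ha
  rw [add_neg_cancel, ← map_mul] at hab
  rw [neg_add_cancel, ← map_mul] at hba
  obtain ⟨c, hc, h⟩ := eq_algebraMap_of_isMonomial_zero hρ hab
  obtain ⟨d, hd, h'⟩ := eq_algebraMap_of_isMonomial_zero hρ hba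
  rw [isUnit_iff_exists_and_exists]
  refine ⟨⟨c⁻¹ • b, ?_⟩, ⟨d⁻¹ • b, ?_⟩⟩
  · rw [mul_smul_comm, h, Algebra.algebraMap_eq_smul_one, smul_smul, inv_mul_cancel₀ hc, one_smul]
  · rw [smul_mul_assoc, h', Algebra.algebraMap_eq_smul_one, smul_smul, inv_mul_cancel₀ hd, one_smul]

/-! ### Explicit elements of `A` acting as the required monomials. -/

variable {b₁ b₂ b₃ : ℂ}

/-- When `b₃ = 0`, `x₂ * x₁` acts through exponents `(0, -1)` and `(0, 1)`. Subtracting a multiple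
of `x₃` removes the second. -/
theorem isMonomial_rep_x₃_inv (hq₀ : q ≠ 0) (hb₁ : b₁ ≠ 0) (hb₃ : b₃ = 0)
    (h₁ : ρ (x₁ q α β) = monomialOp q (1, 0)) (h₂ : ρ (x₂ q α β) = e₂Op q b₁ b₂ b₃)
    (h₃ : ρ (x₃ q α β) = monomialOp q (0, 1)) :
    IsMonomial q (ρ (x₂ q α β * x₁ q α β + (-(b₂ * q ^ (2 : ℤ))) • x₃ q α β)) (-(0, 1)) := by
  refine ⟨b₁ * q ^ (-2 : ℤ), mul_ne_zero hb₁ (zpow_ne_zero _ hq₀), ?_⟩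
  rw [map_add, map_mul, map_smul, h₁, h₂, h₃, e₂Op, hb₃]
  simp only [add_mul, smul_mul_assoc, monomialOp_mul hq₀, Prod.mk_add_mk, smul_smul, Prod.neg_mk]
  norm_num
  module

theorem rep_x₂_mul_x₃ (hq₀ : q ≠ 0) (hb₁ : b₁ = 0)
    (h₂ : ρ (x₂ q α β) = e₂Op q b₁ b₂ b₃) (h₃ : ρ (x₃ q α β) = monomialOp q (0, 1)) :
    ρ (x₂ q α β * x₃ q α β + algebraMap ℂ _ (-b₃)) = b₂ • monomialOp q (-1, 2) := by
  rw [map_add, map_mul, AlgHom.commutes, h₂, h₃, e₂Op, hb₁, Algebra.algebraMap_eq_smul_one,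
    ← monomialOp_zero q]
  simp only [add_mul, smul_mul_assoc, monomialOp_mul hq₀, Prod.mk_add_mk, smul_smul]
  rw [← Prod.mk_zero_zero]
  norm_num
  module

/-- The inner factor isolates exponent `(1, -1)`. Multiplying by `x₂` gives exponents `(0, 0)` and
`(1, -2)`, and the scalar removes the former. -/
theorem isMonomial_rep_x₁_mul_x₃_inv (hq₀ : q ≠ 0) (hb₁ : b₁ = 0) (hb₃ : b₃ ≠ 0)
    (h₁ : ρ (x₁ q α β) = monomialOp q (1, 0)) (h₂ : ρ (x₂ q α β) = e₂Op q b₁ b₂ b₃)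
    (h₃ : ρ (x₃ q α β) = monomialOp q (0, 1)) :
    IsMonomial q (ρ (x₂ q α β * (x₂ q α β * x₁ q α β + (-(b₂ * q ^ (2 : ℤ))) • x₃ q α β)
      + algebraMap ℂ _ (-(b₂ * q ^ (2 : ℤ) * (b₃ * q ^ (-2 : ℤ)))))) (-(-1, 2)) := by
  have e : ρ (x₂ q α β * x₁ q α β + (-(b₂ * q ^ (2 : ℤ))) • x₃ q α β) =
      (b₃ * q ^ (-2 : ℤ)) • monomialOp q (1, -1) := by
    rw [map_add, map_mul, map_smul, h₁, h₂, h₃, e₂Op, hb₁]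
    simp only [add_mul, smul_mul_assoc, monomialOp_mul hq₀, Prod.mk_add_mk, smul_smul]
    norm_num
    module
  refine ⟨b₃ * (b₃ * q ^ (-2 : ℤ)) * q ^ (-2 : ℤ), mul_ne_zero (mul_ne_zero hb₃
    (mul_ne_zero hb₃ (zpow_ne_zero _ hq₀))) (zpow_ne_zero _ hq₀), ?_⟩
  rw [map_add, map_mul, e, AlgHom.commutes, h₂, e₂Op, hb₁, Algebra.algebraMap_eq_smul_one,
    ← monomialOp_zero q]
  simp only [add_mul, smul_mul_assoc, mul_smul_comm, monomialOp_mul hq₀, Prod.mk_add_mk, smul_smul]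
  rw [← Prod.mk_zero_zero]
  norm_num
  match_scalars <;> ring

end Units

end

end UqB2

theorem proposition3p6 (q : ℂ) (hq₀ : q ≠ 0) (hq : ∀ n : ℕ, 0 < n → q ^ n ≠ 1)
    (α β : ℂ) (hαβ : (α, β) ≠ (0, 0)) :
    Nontrivial (UqB2.A q α β) ∧
    (α = 0 →
      ∃ w : (UqB2.A q α β)ˣ,
        (w : UqB2.A q α β) = UqB2.toA q α β (UqB2.e₃ q) ∧
        {a : UqB2.A q α β | IsUnit a} =
          {a | ∃ (c : ℂ) (i : ℤ), c ≠ 0 ∧ a = c • ((w ^ i : (UqB2.A q α β)ˣ) : UqB2.A q α β)}) ∧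
    (β = 0 →
      -- `w` is the element `ẽ₁⁻¹ ẽ₃²`: the unique solution of `ẽ₁ w = ẽ₃²`, with `ẽ₁` regular
      IsRegular (UqB2.toA q α β (UqB2.e₁ q)) ∧
      ∃ w : (UqB2.A q α β)ˣ,
        UqB2.toA q α β (UqB2.e₁ q) * (w : UqB2.A q α β) = UqB2.toA q α β (UqB2.e₃ q) ^ 2 ∧
        {a : UqB2.A q α β | IsUnit a} =
          {a | ∃ (c : ℂ) (i : ℤ), c ≠ 0 ∧ a = c • ((w ^ i : (UqB2.A q α β)ˣ) : UqB2.A q α β)}) ∧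
    (α ≠ 0 → β ≠ 0 →
      {a : UqB2.A q α β | IsUnit a} =
        {a | ∃ c : ℂ, c ≠ 0 ∧ a = algebraMap ℂ (UqB2.A q α β) c}) := by
  open UqB2 in
  obtain ⟨ρ, h₁, h₂, h₃⟩ := exists_torusRep hq₀ hq α β
  have h4 : 1 - q ^ (-4 : ℤ) ≠ 0 := one_sub_zpow_ne_zero hq (n := 4) (by norm_num)
  have h2 : 1 - q ^ (-2 : ℤ) ≠ 0 := one_sub_zpow_ne_zero hq (n := 2) (by norm_num)
  have h4' : q ^ 4 - 1 ≠ 0 := pow_sub_one_ne_zero hq (by norm_num)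
  have h2' : q ^ 2 - 1 ≠ 0 := pow_sub_one_ne_zero hq (by norm_num)
  obtain ⟨b₁, hb₁⟩ : ∃ b, b = β / ((1 - q ^ (-4 : ℤ)) * (1 - q ^ (-2 : ℤ))) := ⟨_, rfl⟩
  obtain ⟨b₂, hb₂⟩ : ∃ b, b = -(q ^ 4 - 1)⁻¹ := ⟨_, rfl⟩
  obtain ⟨b₃, hb₃⟩ : ∃ b, b = -(α / (q ^ 2 - 1)) := ⟨_, rfl⟩
  rw [← hb₁, ← hb₂, ← hb₃] at h₂
  have hb₁' : b₁ = 0 ↔ β = 0 := by rw [hb₁, div_eq_zero_iff, or_iff_left (mul_ne_zero h4 h2)]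
  have hb₂' : b₂ ≠ 0 := by simp [hb₂, h4']
  have hb₃' : b₃ = 0 ↔ α = 0 := by simp [hb₃, h2']
  have hb : b₁ ≠ 0 ∨ b₃ ≠ 0 := by
    rw [Ne, Ne, hb₁', hb₃', ← not_and_or]
    rintro ⟨rfl, rfl⟩
    exact hαβ rfl
  have hρ : Function.Injective ρ := torusRep_injective hq₀ hq hb₂' hb h₁ h₂ h₃
  have hunit : ∀ a : (A q α β)ˣ, ∃ g, IsMonomial q (ρ a) g := exists_torusRep_unit_eq hq₀ h₁ h₂
  have hneg : ∀ (a : (A q α β)ˣ) g, IsMonomial q (ρ a) g →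
      IsMonomial q (ρ (a⁻¹ : (A q α β)ˣ)) (-g) := by
    intro a g hg
    simpa using hg.zpow hq₀ hunit (-1)
  -- The inequality holds for a unit and its inverse, whose exponents are opposite.
  have hfst : β ≠ 0 → ∀ (a : (A q α β)ˣ) g, IsMonomial q (ρ a) g → g.1 = 0 := by
    intro hβ a g hg
    obtain ⟨d, hd, hd'⟩ := hneg a g hg
    obtain ⟨c, hc, hc'⟩ := hg
    have e₁ := fst_nonneg (mt hb₁'.1 hβ) hb₂' h₁ h₂ hc hc'
    have e₂ := fst_nonneg (mt hb₁'.1 hβ) hb₂' h₁ h₂ hd hd'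
    simp at e₂
    omega
  refine ⟨ρ.toRingHom.domain_nontrivial, ?_, ?_, ?_⟩
  · intro hα
    have hβ : β ≠ 0 := by
      rintro rfl
      exact hαβ (by rw [hα])
    have hw₃ : IsMonomial q (ρ (x₃ q α β)) (0, 1) := by
      rw [h₃]; exact isMonomial_monomialOp _ _
    obtain ⟨w, hw⟩ := isUnit_of_isMonomial hq₀ hρ hw₃
      (isMonomial_rep_x₃_inv hq₀ (mt hb₁'.1 hβ) (hb₃'.2 hα) h₁ h₂ h₃)
    refine ⟨w, hw, setOf_isUnit_eq hq₀ hρ hunit (hw ▸ hw₃) fun a h hh => ⟨h.2, ?_⟩⟩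
    ext
    · simpa using hfst hβ a h hh
    · simp
  · intro hβ
    have hα : α ≠ 0 := by
      rintro rfl
      exact hαβ (by rw [hβ])
    have hb₃n := mt hb₃'.1 hα
    have hreg : IsRegular (ρ (x₁ q α β)) := by
      rw [h₁]; exact (isUnit_monomialOp hq₀ _).isRegular
    -- This is `ẽ₁⁻¹ ẽ₃²`, of exponent `(-1, 2)`, normalised to act as exactly the monomial.
    obtain ⟨x, hx⟩ : ∃ x, x = b₂⁻¹ • (x₂ q α β * x₃ q α β + algebraMap ℂ _ (-b₃)) := ⟨_, rfl⟩
    have hxρ : ρ x = monomialOp q (-1, 2) := by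
      rw [hx, map_smul, rep_x₂_mul_x₃ hq₀ (hb₁'.2 hβ) h₂ h₃, smul_smul, inv_mul_cancel₀ hb₂',
        one_smul]
    have hxm : IsMonomial q (ρ x) (-1, 2) := by
      rw [hxρ]; exact isMonomial_monomialOp _ _
    obtain ⟨w, rfl⟩ := isUnit_of_isMonomial hq₀ hρ hxm
      (isMonomial_rep_x₁_mul_x₃_inv hq₀ (hb₁'.2 hβ) hb₃n h₁ h₂ h₃)
    refine ⟨⟨fun a b hab => hρ (hreg.left ?_), fun a b hab => hρ (hreg.right ?_)⟩, w, hρ ?_,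
      setOf_isUnit_eq hq₀ hρ hunit hxm fun a h hh => ⟨-h.1, ?_⟩⟩
    · simpa only [map_mul, x₁] using congrArg ρ hab
    · simpa only [map_mul, x₁] using congrArg ρ hab
    · change ρ (x₁ q α β * w) = ρ (x₃ q α β ^ 2)
      rw [map_mul, map_pow, h₁, h₃, hxρ, pow_two, monomialOp_mul hq₀, monomialOp_mul hq₀]
      norm_num
    · obtain ⟨d, hd, hd'⟩ := hneg a h hh
      obtain ⟨c, hc, hc'⟩ := hh
      have e₁ := two_mul_fst_add_snd_nonneg (hb₁'.2 hβ) hb₂' hb₃n h₁ h₂ hq₀ hc hc'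
      have e₂ := two_mul_fst_add_snd_nonneg (hb₁'.2 hβ) hb₂' hb₃n h₁ h₂ hq₀ hd hd'
      simp at e₂
      ext
      · simp
      · simp
        omega
  · intro hα hβ
    have hw : IsMonomial q (ρ (1 : (A q α β)ˣ)) 0 := by
      simpa using isMonomial_one q
    rw [setOf_isUnit_eq hq₀ hρ hunit hw fun a h hh => ⟨0, ?_⟩]
    · ext a
      simp [Algebra.algebraMap_eq_smul_one]
    · have h0 := hfst hβ a h hh
      obtain ⟨d, hd, hd'⟩ := hneg a h hh
      obtain ⟨c, hc, hc'⟩ := hh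
      have e₁ := snd_nonneg (mt hb₁'.1 hβ) (mt hb₃'.1 hα) h₁ h₂ hq₀ hc hc'
      have e₂ := snd_nonneg (mt hb₁'.1 hβ) (mt hb₃'.1 hα) h₁ h₂ hq₀ hd hd'
      simp at e₂
      ext
      · simpa using h0
      · simp
        omega
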